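/- Let $(\Omega,d)$ be a metric space. A structured object over $\Omega$ is a triplet $(X\times A,d_X,\mu)$, where $(X,d_X)$ is a compact metric space, $A\subseteq\Omega$ is compact, and $\mu$ is a fully supported Borel probability measure on $X\times A$. For structured objects $(X\times A,d_X,\mu)$ and $(Y\times B,d_Y,\nu)$ let $\Pi(\mu,\nu)$ be the set of probability measures on $(X\times A)\times(Y\times B)$ with marginals $\mu$ and $\nu$. For real numbers $p,q\ge 1$ and $\alpha\in\,]0,1[$ and $\pi\in\Pi(\mu,\nu)$ put $$E_{p,q,\alpha}(\pi)=\iint\big((1-\alpha)\,d(a,b)^q+\alpha\,|d_X(x,x')-d_Y(y,y')|^q\big)^p\,d\pi((x,a),(y,b))\,d\pi((x',a'),(y',b'))$$ and $$d_{FGW,\alpha,p,q}(\mu,\nu)=\Big(\inf_{\pi\in\Pi(\mu,\nu)}E_{p,q,\alpha}(\pi)\Big)^{1/p}.$$ **Theorem (Metric properties).** Let $p,q\ge 1$ be real and $\alpha\in\,]0,1[$. For all structured objects over $\Omega$: 1. The integrand defining $E_{p,q,\alpha}(\pi)$ is integrable for every $\pi\in\Pi(\mu,\nu)$, and $E_{p,q,\alpha}$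 attains its infimum over $\Pi(\mu,\nu)$ at some $\pi^*$, so that $d_{FGW,\alpha,p,q}(\mu,\nu)=E_{p,q,\alpha}(\pi^*)^{1/p}$. 2. $d_{FGW,\alpha,p,q}(\mu,\nu)=0$ if and only if there is a map $f:X\times A\to Y\times B$ of the form $f(x,a)=(f_1(x),f_2(a))$ such that $f\#\mu=\nu$, $f_1:X\to Y$ is an isometry (a surjective distance-preserving map), and $f_2:A\to B$ is the identity map (in particular $A=B$). 3. $d_{FGW,\alpha,p,q}$ is symmetric: $d_{FGW,\alpha,p,q}(\mu,\nu)=d_{FGW,\alpha,p,q}(\nu,\mu)$. 4. If $q=1$, then $d_{FGW,\alpha,p,q}$ satisfies the triangle inequality. 5. If $q\ge 2$, then $d_{FGW,\alpha,p,q}(\mu,\rho)\le 2^{q-1}\big(d_{FGW,\alpha,p,q}(\mu,\nu)+d_{FGW,\alpha,p,q}(\nu,\rho)\big)$ for any third structured object with measure $\rho$. -/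

import Mathlib

open MeasureTheory

universe u v t w

/-- A structured object `(X × A, d_X, μ)` over the feature space `(Ω, d)`: a compact metric space
`X` (with its Borel σ-algebra), a compact subset `A` of `Ω`, and a fully supported Borel
probability measure `μ` on `X × A`. -/
structure StructuredObject (Ω : Type w) [MetricSpace Ω] [MeasurableSpace Ω] :
    Type (max (u + 1) w) where
  X : Type u
  [metricSpaceX : MetricSpace X]
  [compactSpaceX : CompactSpace X]
  [measurableSpaceX : MeasurableSpace X]
  [borelSpaceX : BorelSpace X]
  A : Set Ω
  isCompact_A : IsCompact A
  μ : Measure (X × A)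
  [isProbabilityMeasure : IsProbabilityMeasure μ]
  support_eq : μ.support = Set.univ

namespace StructuredObject


attribute [instance] metricSpaceX compactSpaceX measurableSpaceX borelSpaceX isProbabilityMeasure

variable {Ω : Type w} [MetricSpace Ω] [MeasurableSpace Ω]

/-- The couplings `Π(μ, ν)`: measures on the product with marginals `μ` and `ν`
(they are automatically probability measures). -/
def couplings (S : StructuredObject.{u, w} Ω) (T : StructuredObject.{v, w} Ω) :
    Set (Measure ((S.X × S.A) × (T.X × T.A))) :=
  {π | π.map Prod.fst = S.μ ∧ π.map Prod.snd = T.μ}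

/-- The integrand
`((1 - α) d(a, b) ^ q + α |d_X(x, x') - d_Y(y, y')| ^ q) ^ p`
at the pair of points `z = (((x, a), (y, b)), ((x', a'), (y', b')))`. -/
noncomputable def fgwCost (α p q : ℝ) (S : StructuredObject.{u, w} Ω)
    (T : StructuredObject.{v, w} Ω)
    (z : ((S.X × S.A) × (T.X × T.A)) × ((S.X × S.A) × (T.X × T.A))) : ℝ :=
  ((1 - α) * dist (z.1.1.2 : Ω) (z.1.2.2 : Ω) ^ q
    + α * |dist z.1.1.1 z.2.1.1 - dist z.1.2.1 z.2.2.1| ^ q) ^ p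

/-- The objective `E_{p,q,α}(π)`. -/
noncomputable def fgwEnergy (α p q : ℝ) (S : StructuredObject.{u, w} Ω)
    (T : StructuredObject.{v, w} Ω) (π : Measure ((S.X × S.A) × (T.X × T.A))) : ℝ :=
  ∫ z, fgwCost α p q S T z ∂(π.prod π)

/-- The Fused Gromov-Wasserstein distance. -/
noncomputable def fgwDist (α p q : ℝ) (S : StructuredObject.{u, w} Ω)
    (T : StructuredObject.{v, w} Ω) : ℝ :=
  sInf (fgwEnergy α p q S T '' couplings S T) ^ (1 / p)

/-- Equivalence of structured objects: there is a measure preserving map `f = (f₁, f₂)` whose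
structure part `f₁` is a surjective isometry and whose feature part `f₂` is the identity
(so that both objects have the same feature set). -/
def Equivalent (S : StructuredObject.{u, w} Ω) (T : StructuredObject.{v, w} Ω) : Prop :=
  ∃ (f : S.X × S.A → T.X × T.A) (f₁ : S.X → T.X) (f₂ : S.A → T.A),
    (∀ x a, f (x, a) = (f₁ x, f₂ a)) ∧
    MeasurePreserving f S.μ T.μ ∧
    (Isometry f₁ ∧ Function.Surjective f₁) ∧
    (S.A = T.A ∧ ∀ a, (f₂ a : Ω) = (a : Ω))

end StructuredObject

/-!
The cost is a continuous function on a compact metric space, so it is bounded and integrable. The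
couplings of two structured objects form a nonempty closed subset of the compact space of
probability measures on the product, and the energy is weakly continuous there because
`π ↦ π ⊗ π` is; hence a minimiser exists (`exists_isMinOn_fgwEnergy`).

If an optimal coupling `π` has energy zero, the cost vanishes on `supp π × supp π`
(`fgwCost_eq_zero_of_mem_support`). Since the marginals of `π` have full support and the spaces are
compact, `supp π` projects onto both factors. Vanishing of the feature part of the cost says that
`a = b` on `supp π`; vanishing of the structure part says that `supp π` preserves the distances of
the structure spaces. So `supp π` is the graph of a map `(f₁, id)` with `f₁` an isometry, and this
map pushes the first marginal to the second. Conversely the coupling carried by the graph of an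
equivalence has energy zero.

For the triangle inequality, couplings of `(μ, ν)` and `(ν, ρ)` are glued along `ν` by
disintegrating the second one (`exists_glued_measure`). The base of the cost satisfies
`B(x, z) ≤ 2 ^ (q - 1) * (B(x, y) + B(y, z))` by convexity of `t ↦ t ^ q`, and Minkowski's
inequality in `L^p` of the product of the glued measure with itself concludes. For `q = 1` the
constant is `1`.
-/

open MeasureTheory ProbabilityTheory Filter

/-! ### Gluing of couplings and Minkowski's inequality -/

/-- **Gluing lemma**: if the second marginal of `π` is the first marginal of `θ`, there is a measure
on the triple product whose first two coordinates have law `π` and whose last two have law `θ`.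
It is `π` composed with the conditional kernel of `θ` given its first coordinate. -/
lemma exists_glued_measure {P Q R : Type*} [MeasurableSpace P] [MeasurableSpace Q]
    [MeasurableSpace R] [StandardBorelSpace R] [Nonempty R]
    (π : Measure (P × Q)) (θ : Measure (Q × R)) [IsProbabilityMeasure π] [IsProbabilityMeasure θ]
    (h : π.map Prod.snd = θ.map Prod.fst) :
    ∃ σ : Measure ((P × Q) × R), IsProbabilityMeasure σ ∧
      σ.map Prod.fst = π ∧ σ.map (fun w ↦ (w.1.2, w.2)) = θ := by
  refine ⟨π ⊗ₘ (θ.condKernel.comap Prod.snd measurable_snd), inferInstance,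
    Measure.fst_compProd _ _, ?_⟩
  conv_rhs => rw [← θ.disintegrate θ.condKernel]
  ext s hs
  have hm : Measurable fun w : (P × Q) × R ↦ (w.1.2, w.2) := by fun_prop
  have hk : Measurable fun b ↦ θ.condKernel b (Prod.mk b ⁻¹' s) :=
    Kernel.measurable_kernel_prodMk_left hs
  rw [Measure.map_apply hm hs, Measure.compProd_apply (hm hs), Measure.compProd_apply hs,
    Measure.fst, ← h, lintegral_map hk measurable_snd]
  rfl

/-- Minkowski's inequality for continuous functions on a compact space, in terms of real-valued
integrals and with a multiplicative constant. -/
lemma rpow_integral_rpow_le_of_le_mul_add {W : Type*} [TopologicalSpace W] [CompactSpace W]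
    [MeasurableSpace W] [OpensMeasurableSpace W] {μ : Measure W}
    [IsFiniteMeasure μ] {f g h : W → ℝ} {p C : ℝ} (hp : 1 ≤ p) (hC : 0 ≤ C)
    (hf : Continuous f) (hg : Continuous g) (hh : Continuous h)
    (hf0 : ∀ w, 0 ≤ f w) (hg0 : ∀ w, 0 ≤ g w) (hh0 : ∀ w, 0 ≤ h w)
    (hle : ∀ w, h w ≤ C * (f w + g w)) :
    (∫ w, h w ^ p ∂μ) ^ (1 / p) ≤
      C * ((∫ w, f w ^ p ∂μ) ^ (1 / p) + (∫ w, g w ^ p ∂μ) ^ (1 / p)) := by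
  have hp0 : 0 < p := by linarith
  have int {k : W → ℝ} (hk : Continuous k) : Integrable k μ :=
    hk.integrable_of_hasCompactSupport (HasCompactSupport.of_compactSpace k)
  have norm_eq {k : W → ℝ} (hk : Continuous k) (hk0 : ∀ w, 0 ≤ k w) :
      lpNorm k (ENNReal.ofReal p) μ = (∫ w, k w ^ p ∂μ) ^ (1 / p) := by
    rw [lpNorm_eq_integral_norm_rpow_toReal (by simpa using hp0) ENNReal.ofReal_ne_top
      (int hk).aestronglyMeasurable, ENNReal.toReal_ofReal hp0.le, one_div]
    simp_rw [Real.norm_of_nonneg (hk0 _)]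
  have memLp : MemLp f (ENNReal.ofReal p) μ := by
    refine (integrable_norm_rpow_iff (int hf).aestronglyMeasurable (by simpa using hp0)
      ENNReal.ofReal_ne_top).1 (int ?_)
    exact hf.norm.rpow_const fun _ ↦ Or.inr ENNReal.toReal_nonneg
  rw [← norm_eq hf hf0, ← norm_eq hg hg0]
  refine le_trans ?_ (mul_le_mul_of_nonneg_left
    (lpNorm_add_le memLp (by simpa using hp)) hC)
  rw [norm_eq (hf.add hg) fun w ↦ add_nonneg (hf0 w) (hg0 w)]
  have pull : C * (∫ w, (f + g) w ^ p ∂μ) ^ (1 / p)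
      = (∫ w, (C * (f w + g w)) ^ p ∂μ) ^ (1 / p) := by
    simp_rw [Real.mul_rpow hC (add_nonneg (hf0 _) (hg0 _)), Pi.add_apply, integral_const_mul]
    rw [Real.mul_rpow (by positivity)
      (integral_nonneg fun w ↦ Real.rpow_nonneg (add_nonneg (hf0 w) (hg0 w)) p),
      ← Real.rpow_mul hC, mul_one_div_cancel hp0.ne', Real.rpow_one]
  rw [pull]
  refine Real.rpow_le_rpow (integral_nonneg fun w ↦ Real.rpow_nonneg (hh0 w) p) ?_ (by positivity)
  refine integral_mono (int (hh.rpow_const fun _ ↦ Or.inr hp0.le))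
    (int (((hf.add hg).const_mul C).rpow_const fun _ ↦ Or.inr hp0.le)) fun w ↦ ?_
  exact Real.rpow_le_rpow (hh0 w) (hle w) hp0.le

lemma rpow_le_two_rpow_mul_add {a b c q : ℝ} (ha : 0 ≤ a) (hb : 0 ≤ b) (hc : 0 ≤ c) (hq : 1 ≤ q)
    (h : c ≤ a + b) : c ^ q ≤ 2 ^ (q - 1) * (a ^ q + b ^ q) := by
  refine (Real.rpow_le_rpow hc h (by linarith)).trans ?_
  lift a to NNReal using ha
  lift b to NNReal using hb
  have := NNReal.rpow_add_le_mul_rpow_add_rpow a b hq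
  exact_mod_cast this

lemma continuous_integral_prod_self {Z : Type*} [TopologicalSpace Z] [CompactSpace Z]
    [TopologicalSpace.PseudoMetrizableSpace Z] [SecondCountableTopology Z] [MeasurableSpace Z]
    [BorelSpace Z] (c : C(Z × Z, ℝ)) :
    Continuous fun π : ProbabilityMeasure Z ↦ ∫ z, c z ∂((π : Measure Z).prod π) :=
  (ProbabilityMeasure.continuous_integral_continuousMap c).comp
    (ProbabilityMeasure.continuous_prod.comp (continuous_id.prodMk continuous_id))

/-! ### Supports of couplings -/

lemma prod_subset_support_prod {Z W : Type*} [TopologicalSpace Z] [MeasurableSpace Z]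
    [TopologicalSpace W] [MeasurableSpace W] (π : Measure Z) (θ : Measure W) [SFinite θ] :
    π.support ×ˢ θ.support ⊆ (π.prod θ).support := by
  rintro ⟨z, w⟩ ⟨hz, hw⟩
  rw [Measure.mem_support_iff_forall] at hz hw ⊢
  intro U hU
  obtain ⟨u, hu, v, hv, huv⟩ := mem_nhds_prod_iff.1 hU
  refine lt_of_lt_of_le ?_ (measure_mono huv)
  rw [Measure.prod_prod]
  exact ENNReal.mul_pos (hz u hu).ne' (hw v hv).ne'

/-- On a compact space the support of a measure projects onto a space where the image measure is
fully supported: the image of the support is closed and of full measure. -/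
lemma image_support_eq_univ_of_map {Z W : Type*} [TopologicalSpace Z] [MeasurableSpace Z]
    [OpensMeasurableSpace Z] [HereditarilyLindelofSpace Z] [CompactSpace Z] [TopologicalSpace W]
    [T2Space W] [MeasurableSpace W] [BorelSpace W] {π : Measure Z} {f : Z → W} (hf : Continuous f)
    (h : (π.map f).support = Set.univ) : f '' π.support = Set.univ := by
  have hcl : IsClosed (f '' π.support) :=
    (Measure.isClosed_support.isCompact.image hf).isClosed
  refine Set.eq_univ_of_univ_subset (h ▸ Measure.support_subset_of_isClosed hcl ?_)
  rw [mem_ae_map_iff hf.measurable.aemeasurable hcl.measurableSet]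
  exact mem_of_superset Measure.support_mem_ae (Set.subset_preimage_image f _)

namespace StructuredObject

variable {Ω : Type w} [MetricSpace Ω] [MeasurableSpace Ω]

instance compactSpaceA (S : StructuredObject.{u, w} Ω) : CompactSpace S.A :=
  isCompact_iff_compactSpace.mp S.isCompact_A

instance nonemptyProd (S : StructuredObject.{u, w} Ω) : Nonempty (S.X × S.A) :=
  nonempty_of_isProbabilityMeasure S.μ

lemma isProbabilityMeasure_of_mem_couplings {S : StructuredObject.{u, w} Ω}
    {T : StructuredObject.{v, w} Ω} {π : Measure ((S.X × S.A) × (T.X × T.A))}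
    (hπ : π ∈ S.couplings T) : IsProbabilityMeasure π :=
  have : IsProbabilityMeasure (π.map Prod.fst) := hπ.1 ▸ S.isProbabilityMeasure
  Measure.isProbabilityMeasure_of_map Prod.fst

lemma couplings_nonempty (S : StructuredObject.{u, w} Ω) (T : StructuredObject.{v, w} Ω) :
    (S.couplings T).Nonempty :=
  ⟨S.μ.prod T.μ, by simp [Measure.map_fst_prod], by simp [Measure.map_snd_prod]⟩

/-! ### The cost and the energy -/

/-- The base `(1 - α) d(a, b) ^ q + α |d_X(x, x') - d_Y(y, y')| ^ q` of the cost, before raising it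
to the power `p`. -/
noncomputable def fgwCostBase (α q : ℝ) (S : StructuredObject.{u, w} Ω)
    (T : StructuredObject.{v, w} Ω)
    (z : ((S.X × S.A) × (T.X × T.A)) × ((S.X × S.A) × (T.X × T.A))) : ℝ :=
  (1 - α) * dist (z.1.1.2 : Ω) (z.1.2.2 : Ω) ^ q
    + α * |dist z.1.1.1 z.2.1.1 - dist z.1.2.1 z.2.2.1| ^ q

section

variable {α p q : ℝ} {S : StructuredObject.{u, w} Ω} {T : StructuredObject.{v, w} Ω}
  {R : StructuredObject.{t, w} Ω}

lemma fgwCostBase_nonneg (hα : α ∈ Set.Ioo (0 : ℝ) 1) (z) : 0 ≤ S.fgwCostBase α q T z := by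
  have h1 : 0 ≤ 1 - α := by linarith [hα.2]
  have h2 := hα.1.le
  unfold fgwCostBase
  positivity

lemma fgwCost_nonneg (hα : α ∈ Set.Ioo (0 : ℝ) 1) (z) : 0 ≤ S.fgwCost α p q T z :=
  Real.rpow_nonneg (fgwCostBase_nonneg hα z) p

lemma continuous_fgwCostBase (hq : 0 ≤ q) : Continuous (S.fgwCostBase α q T) := by
  unfold fgwCostBase
  refine ((Continuous.rpow_const (by fun_prop) fun _ ↦ Or.inr hq).const_mul _).add
    ((Continuous.rpow_const (by fun_prop) fun _ ↦ Or.inr hq).const_mul _)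

lemma continuous_fgwCost (hp : 0 ≤ p) (hq : 0 ≤ q) : Continuous (S.fgwCost α p q T) :=
  (continuous_fgwCostBase hq).rpow_const fun _ ↦ Or.inr hp

lemma fgwEnergy_nonneg (hα : α ∈ Set.Ioo (0 : ℝ) 1) (π) : 0 ≤ S.fgwEnergy α p q T π :=
  integral_nonneg (fgwCost_nonneg hα)

lemma fgwCost_eq_zero_iff (hα : α ∈ Set.Ioo (0 : ℝ) 1) (hp : p ≠ 0) (hq : q ≠ 0) (z) :
    S.fgwCost α p q T z = 0 ↔
      (z.1.1.2 : Ω) = z.1.2.2 ∧ dist z.1.1.1 z.2.1.1 = dist z.1.2.1 z.2.2.1 := by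
  have h1 : 0 < 1 - α := by linarith [hα.2]
  have h2 := hα.1
  change S.fgwCostBase α q T z ^ p = 0 ↔ _
  rw [Real.rpow_eq_zero (fgwCostBase_nonneg hα z) hp, fgwCostBase,
    add_eq_zero_iff_of_nonneg (by positivity) (by positivity), mul_eq_zero, mul_eq_zero,
    Real.rpow_eq_zero dist_nonneg hq, Real.rpow_eq_zero (abs_nonneg _) hq, dist_eq_zero,
    abs_eq_zero, or_iff_right h1.ne', or_iff_right h2.ne', sub_eq_zero]

lemma fgwCostBase_le_mul_add (hα : α ∈ Set.Ioo (0 : ℝ) 1) (hq : 1 ≤ q)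
    (s s' : S.X × S.A) (r r' : T.X × T.A) (o o' : R.X × R.A) :
    S.fgwCostBase α q R ((s, o), (s', o')) ≤ 2 ^ (q - 1) *
      (S.fgwCostBase α q T ((s, r), (s', r')) + T.fgwCostBase α q R ((r, o), (r', o'))) := by
  have h1 := rpow_le_two_rpow_mul_add dist_nonneg dist_nonneg dist_nonneg hq
    (dist_triangle (s.2 : Ω) r.2 o.2)
  have h2 := rpow_le_two_rpow_mul_add (abs_nonneg _) (abs_nonneg _) (abs_nonneg _) hq
    (abs_sub_le (dist s.1 s'.1) (dist r.1 r'.1) (dist o.1 o'.1))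
  have h3 := mul_le_mul_of_nonneg_left h1 (by linarith [hα.2] : 0 ≤ 1 - α)
  have h4 := mul_le_mul_of_nonneg_left h2 hα.1.le
  simp only [fgwCostBase]
  linarith

lemma fgwDist_eq_of_isMinOn {π : Measure ((S.X × S.A) × (T.X × T.A))} (hπ : π ∈ S.couplings T)
    (hmin : IsMinOn (S.fgwEnergy α p q T) (S.couplings T) π) :
    S.fgwDist α p q T = S.fgwEnergy α p q T π ^ (1 / p) := by
  have : IsLeast (S.fgwEnergy α p q T '' S.couplings T) (S.fgwEnergy α p q T π) :=
    ⟨Set.mem_image_of_mem _ hπ, Set.forall_mem_image.2 fun θ hθ ↦ hmin hθ⟩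
  rw [fgwDist, this.csInf_eq]

lemma fgwDist_nonneg (hα : α ∈ Set.Ioo (0 : ℝ) 1) : 0 ≤ S.fgwDist α p q T :=
  Real.rpow_nonneg (Real.sInf_nonneg (Set.forall_mem_image.2 fun π _ ↦ fgwEnergy_nonneg hα π)) _

lemma fgwDist_le_of_mem_couplings (hα : α ∈ Set.Ioo (0 : ℝ) 1) (hp : 0 ≤ p)
    {π : Measure ((S.X × S.A) × (T.X × T.A))} (hπ : π ∈ S.couplings T) :
    S.fgwDist α p q T ≤ S.fgwEnergy α p q T π ^ (1 / p) := by
  refine Real.rpow_le_rpow (Real.sInf_nonneg (Set.forall_mem_image.2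
    fun π _ ↦ fgwEnergy_nonneg hα π)) (csInf_le ⟨0, ?_⟩ (Set.mem_image_of_mem _ hπ)) (by positivity)
  exact Set.forall_mem_image.2 fun θ _ ↦ fgwEnergy_nonneg hα θ

end

variable [BorelSpace Ω]

section

variable {α p q : ℝ} {S : StructuredObject.{u, w} Ω} {T : StructuredObject.{v, w} Ω}

lemma integrable_fgwCost (hp : 0 ≤ p) (hq : 0 ≤ q)
    (π : Measure ((S.X × S.A) × (T.X × T.A))) [IsFiniteMeasure π] :
    Integrable (S.fgwCost α p q T) (π.prod π) :=
  (continuous_fgwCost hp hq).integrable_of_hasCompactSupport (HasCompactSupport.of_compactSpace _)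

/-- Energies of push-forward plans, written as integrals over the source: this is how the couplings
obtained from a glued measure, or from a swap, are handled. -/
lemma fgwEnergy_map {W : Type*} [MeasurableSpace W] (hp : 0 ≤ p) (hq : 0 ≤ q) (σ : Measure W)
    [IsFiniteMeasure σ] {g : W → (S.X × S.A) × (T.X × T.A)} (hg : Measurable g) :
    S.fgwEnergy α p q T (σ.map g) = ∫ z, S.fgwCost α p q T (g z.1, g z.2) ∂(σ.prod σ) := by
  rw [fgwEnergy, Measure.map_prod_map σ σ hg hg, integral_map (by fun_prop)
    (continuous_fgwCost hp hq).aestronglyMeasurable]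
  rfl

/-! ### Existence of optimal couplings -/

lemma exists_isMinOn_fgwEnergy (hp : 0 ≤ p) (hq : 0 ≤ q) (S : StructuredObject.{u, w} Ω)
    (T : StructuredObject.{v, w} Ω) :
    ∃ π₀ ∈ S.couplings T, IsMinOn (S.fgwEnergy α p q T) (S.couplings T) π₀ := by
  let K : Set (ProbabilityMeasure ((S.X × S.A) × (T.X × T.A))) :=
    {π | π.map measurable_fst.aemeasurable = ⟨S.μ, S.isProbabilityMeasure⟩ ∧
      π.map measurable_snd.aemeasurable = ⟨T.μ, T.isProbabilityMeasure⟩}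
  have mem_K (π : ProbabilityMeasure ((S.X × S.A) × (T.X × T.A))) :
      π ∈ K ↔ (π : Measure _) ∈ S.couplings T := by
    refine and_congr ?_ ?_ <;> exact Subtype.ext_iff
  have hK : IsCompact K := IsClosed.isCompact <|
    (isClosed_eq (ProbabilityMeasure.continuous_map continuous_fst) continuous_const).inter
      (isClosed_eq (ProbabilityMeasure.continuous_map continuous_snd) continuous_const)
  have hne : K.Nonempty := by
    obtain ⟨π, hπ⟩ := S.couplings_nonempty T
    exact ⟨⟨π, isProbabilityMeasure_of_mem_couplings hπ⟩, (mem_K _).2 hπ⟩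
  let c : C(((S.X × S.A) × (T.X × T.A)) × ((S.X × S.A) × (T.X × T.A)), ℝ) :=
    ⟨S.fgwCost α p q T, continuous_fgwCost hp hq⟩
  have hE : Continuous fun π : ProbabilityMeasure ((S.X × S.A) × (T.X × T.A)) ↦
      S.fgwEnergy α p q T π :=
    continuous_integral_prod_self c
  obtain ⟨π₀, hπ₀, hmin⟩ := hK.exists_isMinOn hne hE.continuousOn
  refine ⟨π₀, (mem_K _).1 hπ₀, fun π hπ ↦ ?_⟩
  exact hmin ((mem_K ⟨π, isProbabilityMeasure_of_mem_couplings hπ⟩).2 hπ)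


/-! ### Vanishing of the distance -/

lemma fgwCost_eq_zero_of_mem_support (hα : α ∈ Set.Ioo (0 : ℝ) 1) (hp : 0 ≤ p) (hq : 0 ≤ q)
    {π : Measure ((S.X × S.A) × (T.X × T.A))} [IsFiniteMeasure π]
    (hE : S.fgwEnergy α p q T π = 0) {z z'} (hz : z ∈ π.support) (hz' : z' ∈ π.support) :
    S.fgwCost α p q T (z, z') = 0 := by
  have hcl : IsClosed {z | S.fgwCost α p q T z = 0} :=
    isClosed_eq (continuous_fgwCost hp hq) continuous_const
  have hae := (integral_eq_zero_iff_of_nonneg (fgwCost_nonneg hα)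
    (integrable_fgwCost hp hq π)).1 hE
  exact Measure.support_subset_of_isClosed hcl hae
    (prod_subset_support_prod π π (Set.mk_mem_prod hz hz'))

/-- A coupling of zero energy is carried by the graph of an equivalence. -/
lemma equivalent_of_fgwEnergy_eq_zero (hα : α ∈ Set.Ioo (0 : ℝ) 1) (hp : 0 < p) (hq : 0 < q)
    {π : Measure ((S.X × S.A) × (T.X × T.A))} (hπ : π ∈ S.couplings T)
    (hE : S.fgwEnergy α p q T π = 0) : S.Equivalent T := by
  have := isProbabilityMeasure_of_mem_couplings hπ
  have key {z z'} (hz : z ∈ π.support) (hz' : z' ∈ π.support) :=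
    (fgwCost_eq_zero_iff hα hp.ne' hq.ne' (z, z')).1
      (fgwCost_eq_zero_of_mem_support hα hp.le hq.le hE hz hz')
  have left (s : S.X × S.A) : ∃ r, (s, r) ∈ π.support := by
    have : s ∈ Prod.fst '' π.support := by
      rw [image_support_eq_univ_of_map continuous_fst (hπ.1 ▸ S.support_eq)]; trivial
    obtain ⟨⟨_, r⟩, h, rfl⟩ := this
    exact ⟨r, h⟩
  have right (r : T.X × T.A) : ∃ s, (s, r) ∈ π.support := by
    have : r ∈ Prod.snd '' π.support := by
      rw [image_support_eq_univ_of_map continuous_snd (hπ.2 ▸ T.support_eq)]; trivial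
    obtain ⟨⟨s, _⟩, h, rfl⟩ := this
    exact ⟨s, h⟩
  obtain ⟨x₀, a₀⟩ := Classical.arbitrary (S.X × S.A)
  obtain ⟨y₀, b₀⟩ := Classical.arbitrary (T.X × T.A)
  choose g hg using fun x ↦ left (x, a₀)
  have hA : S.A = T.A := by
    ext a
    constructor
    · intro ha
      obtain ⟨r, hr⟩ := left (x₀, ⟨a, ha⟩)
      exact (show a = r.2 from (key hr hr).1) ▸ r.2.2
    · intro ha
      obtain ⟨s, hs⟩ := right (y₀, ⟨a, ha⟩)
      exact (show (s.2 : Ω) = a from (key hs hs).1) ▸ s.2.2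
  let f₂ : S.A → T.A := fun a ↦ ⟨a, hA ▸ a.2⟩
  let f₁ : S.X → T.X := fun x ↦ (g x).1
  have hf₁ : Isometry f₁ := Isometry.of_dist_eq fun x x' ↦ (key (hg x) (hg x')).2.symm
  -- The support is the graph of `(f₁, f₂)`: its points over `x` all lie at distance
  -- `d_X(x, x) = 0` from `f₁ x`.
  have graph {z} (hz : z ∈ π.support) : z.2 = Prod.map f₁ f₂ z.1 := by
    have h1 : dist z.2.1 (f₁ z.1.1) = 0 := by
      simpa [f₁] using (key hz (hg z.1.1)).2.symm
    exact Prod.ext (dist_eq_zero.1 h1) (Subtype.ext (key hz hz).1.symm)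
  have hf₂ : Continuous f₂ := by fun_prop
  have hf : Measurable (Prod.map f₁ f₂) := (hf₁.continuous.prodMap hf₂).measurable
  refine ⟨Prod.map f₁ f₂, f₁, f₂, fun _ _ ↦ rfl, ⟨hf, ?_⟩, ⟨hf₁, fun y ↦ ?_⟩, hA, fun _ ↦ rfl⟩
  · rw [← hπ.1, ← hπ.2, Measure.map_map hf measurable_fst]
    refine Measure.map_congr ?_
    filter_upwards [Measure.support_mem_ae (μ := π)] with z hz
    exact (graph hz).symm
  · obtain ⟨s, hs⟩ := right (y, b₀)
    exact ⟨s.1, (congrArg Prod.fst (graph hs)).symm⟩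

/-- An equivalence yields a coupling of zero energy, carried by its graph. -/
lemma fgwDist_eq_zero_of_equivalent (hα : α ∈ Set.Ioo (0 : ℝ) 1) (hp : 0 < p) (hq : 0 < q)
    (h : S.Equivalent T) : S.fgwDist α p q T = 0 := by
  obtain ⟨f, f₁, f₂, hf, hμ, ⟨hf₁, -⟩, -, hf₂⟩ := h
  have hm : Measurable fun s ↦ (s, f s) := measurable_id.prodMk hμ.measurable
  have hπ : S.μ.map (fun s ↦ (s, f s)) ∈ S.couplings T := by
    refine ⟨?_, ?_⟩
    · rw [Measure.map_map measurable_fst hm]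
      exact Measure.map_id
    · rw [Measure.map_map measurable_snd hm]
      exact hμ.map_eq
  refine le_antisymm ((fgwDist_le_of_mem_couplings hα hp.le hπ).trans ?_) (fgwDist_nonneg hα)
  have hzero (z : (S.X × S.A) × (S.X × S.A)) :
      S.fgwCost α p q T ((z.1, f z.1), (z.2, f z.2)) = 0 := by
    obtain ⟨⟨x, a⟩, ⟨x', a'⟩⟩ := z
    rw [fgwCost_eq_zero_iff hα hp.ne' hq.ne']
    simp [hf, hf₂, hf₁.dist_eq]
  rw [fgwEnergy_map hp.le hq.le S.μ hm]
  simp [hzero, hp.ne']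

/-! ### Symmetry -/

lemma fgwDist_le_swap (hα : α ∈ Set.Ioo (0 : ℝ) 1) (hp : 0 ≤ p) (hq : 0 ≤ q)
    (S : StructuredObject.{u, w} Ω) (T : StructuredObject.{v, w} Ω) :
    S.fgwDist α p q T ≤ T.fgwDist α p q S := by
  obtain ⟨π, hπ, hmin⟩ := exists_isMinOn_fgwEnergy (α := α) hp hq T S
  have := isProbabilityMeasure_of_mem_couplings hπ
  rw [fgwDist_eq_of_isMinOn hπ hmin]
  have hswap : π.map Prod.swap ∈ S.couplings T := by
    refine ⟨?_, ?_⟩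
    · rw [Measure.map_map measurable_fst measurable_swap]
      exact hπ.2
    · rw [Measure.map_map measurable_snd measurable_swap]
      exact hπ.1
  refine (fgwDist_le_of_mem_couplings hα hp hswap).trans_eq ?_
  rw [fgwEnergy_map hp hq π measurable_swap, fgwEnergy]
  congr 2 with z
  simp only [fgwCost, Prod.fst_swap, Prod.snd_swap]
  rw [dist_comm (z.1.2.2 : Ω), abs_sub_comm]

/-! ### The triangle inequality -/

/-- The triangle inequality with constant `2 ^ (q - 1)`, valid for all `q ≥ 1`. -/
lemma fgwDist_le_two_rpow_mul_add (hα : α ∈ Set.Ioo (0 : ℝ) 1) (hp : 1 ≤ p) (hq : 1 ≤ q)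
    (S : StructuredObject.{u, w} Ω) (T : StructuredObject.{v, w} Ω)
    (R : StructuredObject.{t, w} Ω) :
    S.fgwDist α p q R ≤ 2 ^ (q - 1) * (S.fgwDist α p q T + T.fgwDist α p q R) := by
  have hp0 : 0 ≤ p := by linarith
  have hq0 : 0 ≤ q := by linarith
  obtain ⟨π, hπ, hπmin⟩ := exists_isMinOn_fgwEnergy (α := α) hp0 hq0 S T
  obtain ⟨θ, hθ, hθmin⟩ := exists_isMinOn_fgwEnergy (α := α) hp0 hq0 T R
  have := isProbabilityMeasure_of_mem_couplings hπ
  have := isProbabilityMeasure_of_mem_couplings hθ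
  obtain ⟨σ, hσ, hσπ, hσθ⟩ := exists_glued_measure π θ (hπ.2.trans hθ.1.symm)
  have m₂ : Measurable fun w : ((S.X × S.A) × (T.X × T.A)) × (R.X × R.A) ↦ (w.1.2, w.2) := by
    fun_prop
  have m₃ : Measurable fun w : ((S.X × S.A) × (T.X × T.A)) × (R.X × R.A) ↦ (w.1.1, w.2) := by
    fun_prop
  have hρ : σ.map (fun w ↦ (w.1.1, w.2)) ∈ S.couplings R := by
    refine ⟨?_, ?_⟩
    · rw [← hπ.1, ← hσπ, Measure.map_map measurable_fst measurable_fst,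
        Measure.map_map measurable_fst m₃]
      rfl
    · rw [← hθ.2, ← hσθ, Measure.map_map measurable_snd m₂, Measure.map_map measurable_snd m₃]
      rfl
  refine (fgwDist_le_of_mem_couplings hα hp0 hρ).trans ?_
  rw [fgwDist_eq_of_isMinOn hπ hπmin, fgwDist_eq_of_isMinOn hθ hθmin, ← hσπ, ← hσθ,
    fgwEnergy_map hp0 hq0 σ measurable_fst, fgwEnergy_map hp0 hq0 σ m₂,
    fgwEnergy_map hp0 hq0 σ m₃]
  -- Instance search does not find this structure on the square of the space in one go.
  have : OpensMeasurableSpace (((S.X × S.A) × (T.X × T.A)) × (R.X × R.A)) := inferInstance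
  refine rpow_integral_rpow_le_of_le_mul_add hp (by positivity)
    ((continuous_fgwCostBase hq0).comp (by fun_prop))
    ((continuous_fgwCostBase hq0).comp (by fun_prop))
    ((continuous_fgwCostBase hq0).comp (by fun_prop))
    (fun _ ↦ fgwCostBase_nonneg hα _) (fun _ ↦ fgwCostBase_nonneg hα _)
    (fun _ ↦ fgwCostBase_nonneg hα _) fun z ↦ fgwCostBase_le_mul_add hα hq _ _ _ _ _ _

end

end StructuredObject

open StructuredObject in
theorem theorem1 {Ω : Type w} [MetricSpace Ω] [MeasurableSpace Ω] [BorelSpace Ω]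
    {α p q : ℝ} (hα : α ∈ Set.Ioo (0 : ℝ) 1) (hp : 1 ≤ p) (hq : 1 ≤ q) :
    -- the objective is well defined, its infimum is attained, and the distance is given by it
    (∀ (S : StructuredObject.{u, w} Ω) (T : StructuredObject.{v, w} Ω),
      (∀ π ∈ S.couplings T, Integrable (S.fgwCost α p q T) (π.prod π)) ∧
      ∃ π₀ ∈ S.couplings T,
        IsMinOn (S.fgwEnergy α p q T) (S.couplings T) π₀ ∧
        S.fgwDist α p q T = S.fgwEnergy α p q T π₀ ^ (1 / p)) ∧
    -- the distance vanishes exactly on equivalent objects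
    (∀ (S : StructuredObject.{u, w} Ω) (T : StructuredObject.{v, w} Ω),
      S.fgwDist α p q T = 0 ↔ S.Equivalent T) ∧
    -- symmetry
    (∀ (S : StructuredObject.{u, w} Ω) (T : StructuredObject.{v, w} Ω),
      S.fgwDist α p q T = T.fgwDist α p q S) ∧
    -- triangle inequality for `q = 1`
    (q = 1 → ∀ (S : StructuredObject.{u, w} Ω) (T : StructuredObject.{v, w} Ω)
      (R : StructuredObject.{t, w} Ω),
      S.fgwDist α p q R ≤ S.fgwDist α p q T + T.fgwDist α p q R) ∧
    -- relaxed triangle inequality for `q ≥ 2`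
    (2 ≤ q → ∀ (S : StructuredObject.{u, w} Ω) (T : StructuredObject.{v, w} Ω)
      (R : StructuredObject.{t, w} Ω),
      S.fgwDist α p q R ≤ 2 ^ (q - 1) * (S.fgwDist α p q T + T.fgwDist α p q R)) := by
  have hp0 : 0 < p := by linarith
  have hq0 : 0 < q := by linarith
  refine ⟨fun S T ↦ ⟨fun π hπ ↦ ?_, ?_⟩, fun S T ↦ ⟨fun h ↦ ?_, ?_⟩, fun S T ↦ ?_, ?_, ?_⟩
  · have := isProbabilityMeasure_of_mem_couplings hπ
    exact integrable_fgwCost hp0.le hq0.le π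
  · obtain ⟨π₀, hπ₀, hmin⟩ := exists_isMinOn_fgwEnergy (α := α) hp0.le hq0.le S T
    exact ⟨π₀, hπ₀, hmin, fgwDist_eq_of_isMinOn hπ₀ hmin⟩
  · obtain ⟨π₀, hπ₀, hmin⟩ := exists_isMinOn_fgwEnergy (α := α) hp0.le hq0.le S T
    rw [fgwDist_eq_of_isMinOn hπ₀ hmin,
      Real.rpow_eq_zero (fgwEnergy_nonneg hα π₀) (one_div_pos.2 hp0).ne'] at h
    exact equivalent_of_fgwEnergy_eq_zero hα hp0 hq0 hπ₀ h
  · exact fgwDist_eq_zero_of_equivalent hα hp0 hq0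
  · exact le_antisymm (fgwDist_le_swap hα hp0.le hq0.le S T)
      (fgwDist_le_swap hα hp0.le hq0.le T S)
  · intro hq1 S T R
    have h := fgwDist_le_two_rpow_mul_add hα hp hq S T R
    rwa [hq1, sub_self, Real.rpow_zero, one_mul, ← hq1] at h
  · exact fun _ S T R ↦ fgwDist_le_two_rpow_mul_add hα hp hq S T R
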